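/- Let $\mathcal{H}$ be a complex Hilbert space with bounded operators $\mathcal{L}(\mathcal{H})$ and identity operator $\mathbb{1}$. For a measurable space $(X,\mathcal{A})$, a POVM with outcome space $(X,\mathcal{A})$ is a map $E:\mathcal{A}\to\mathcal{L}(\mathcal{H})$ with $E(A)\ge 0$ for all $A\in\mathcal{A}$, $E(X)=\mathbb{1}$, and $E(\bigcup_i A_i)=\sum_i E(A_i)$ in the weak operator topology for every sequence of pairwise disjoint $A_i\in\mathcal{A}$. A completely positive (CP) instrument with outcome space $(\Omega,\mathscr{B})$ is a map $\mathscr{B}\times\mathcal{L}(\mathcal{H})\to\mathcal{L}(\mathcal{H})$, $(B,a)\mapsto\mathcal{I}_B(a)$, such that each $\mathcal{I}_B$ is a normal (that is, ultraweakly continuous) completely positive linear map, $\mathcal{I}_{\bigcup_i B_i}(a)=\sum_i\mathcal{I}_{B_i}(a)$ in the ultraweak topology for every sequence of pairwise disjoint $B_i\in\mathscr{B}$ and every $a\in\mathcal{L}(\mathcal{H})$, and $\mathcal{I}_\Omega(\mathbb{1})=\mathbb{1}$. Theorem. Let $\mathcal{I}$ be a CP instrument with a standard Borel outcome space $(\Omega,\mathscr{B})$.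 Then there exists a unique POVM $E_\infty$ with outcome space the countably infinite product $(\Omega^\infty,\mathscr{B}^\infty)$ (with the product $\sigma$-algebra) such that $$E_\infty(B_1\times\cdots\times B_n\times\Omega^\infty)=\mathcal{I}_{B_1}\circ\cdots\circ\mathcal{I}_{B_n}(\mathbb{1})$$ for each $n\ge 1$ and all $B_1,\dots,B_n\in\mathscr{B}$. (This $E_\infty$ is called the infinite composition of $\mathcal{I}$.) -/

import Mathlib

open MeasureTheory
open scoped CStarAlgebra

noncomputable section

/-- The ultraweak (`σ`-weak) topology on the bounded operators of a Hilbert space: the coarsest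
topology for which all functionals `a ↦ ∑ₙ ⟨xₙ, a yₙ⟩`, with `(xₙ)` and `(yₙ)` square-summable
sequences of vectors, are continuous.  (These series converge absolutely.) -/
@[reducible] def ultraweakTopology (H : Type*) [NormedAddCommGroup H] [InnerProductSpace ℂ H] :
    TopologicalSpace (H →L[ℂ] H) :=
  ⨅ (x : ℕ → H) (y : ℕ → H) (_ : Summable fun n => ‖x n‖ ^ 2)
    (_ : Summable fun n => ‖y n‖ ^ 2),
    TopologicalSpace.induced (fun a : H →L[ℂ] H => ∑' n, inner ℂ (x n) (a (y n))) inferInstance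

/-- A positive-operator valued measure on the measurable space `Ω` with values in the bounded
operators on `H`.  The underlying vector measure expresses countable additivity in the weak
operator topology (and assigns the value `0` to every non-measurable set, by convention). -/
structure POVM (Ω : Type*) [MeasurableSpace Ω] (H : Type*) [NormedAddCommGroup H]
    [InnerProductSpace ℂ H] [CompleteSpace H] where
  toVectorMeasure : VectorMeasure Ω (H →WOT[ℂ] H)
  nonneg : ∀ B : Set Ω, MeasurableSet B → 0 ≤ (toVectorMeasure B).toCLM
  univ : (toVectorMeasure Set.univ).toCLM = 1

/-- The bounded operator `E(B)`. -/
def POVM.eval {Ω : Type*} [MeasurableSpace Ω] {H : Type*} [NormedAddCommGroup H]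
    [InnerProductSpace ℂ H] [CompleteSpace H] (E : POVM Ω H) (B : Set Ω) : H →L[ℂ] H :=
  (E.toVectorMeasure B).toCLM

/-- A completely positive instrument (in the Heisenberg picture) with outcome space `Ω`: a family
of normal completely positive linear maps on the bounded operators on `H`, indexed by the
measurable subsets of `Ω`, which is countably additive pointwise in the ultraweak topology and
satisfies `I_Ω(1) = 1`.  Normality is continuity for the ultraweak topology. -/
structure CPInstrument (Ω : Type*) [MeasurableSpace Ω] (H : Type*) [NormedAddCommGroup H]
    [InnerProductSpace ℂ H] [CompleteSpace H] where
  toMap : {B : Set Ω // MeasurableSet B} → ((H →L[ℂ] H) →CP (H →L[ℂ] H))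
  normal : ∀ B : {B : Set Ω // MeasurableSet B},
    @Continuous _ _ (ultraweakTopology H) (ultraweakTopology H) (toMap B)
  hasSum_iUnion : ∀ (B : ℕ → Set Ω) (hB : ∀ i, MeasurableSet (B i)),
    Pairwise (Function.onFun Disjoint B) → ∀ a : H →L[ℂ] H,
      letI : TopologicalSpace (H →L[ℂ] H) := ultraweakTopology H
      HasSum (fun i => toMap ⟨B i, hB i⟩ a) (toMap ⟨⋃ i, B i, MeasurableSet.iUnion hB⟩ a)
  univ_one : toMap ⟨Set.univ, MeasurableSet.univ⟩ 1 = 1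

/-- `I.comp n B` is the composition `I_{B 0} ∘ I_{B 1} ∘ ⋯ ∘ I_{B (n - 1)}`. -/
def CPInstrument.comp {Ω : Type*} [MeasurableSpace Ω] {H : Type*} [NormedAddCommGroup H]
    [InnerProductSpace ℂ H] [CompleteSpace H] (I : CPInstrument Ω H) :
    (n : ℕ) → (Fin n → {B : Set Ω // MeasurableSet B}) → (H →L[ℂ] H) → (H →L[ℂ] H)
  | 0, _ => id
  | n + 1, B => I.toMap (B 0) ∘ I.comp n (fun i => B i.succ)

end

/-!
For a vector `ψ`, the numbers `⟪ψ, I_{B 0} ∘ ⋯ ∘ I_{B (n - 1)} (1) ψ⟫` should be the masses of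
cylinders under a measure `μ ψ` on `ℕ → Ω`, for unit `ψ` the distribution of the outcomes of
repeated measurements. They are consistent because `I_Ω (1) = 1`, and they are countably additive
in each `B i` separately: the instrument is countably additive and the maps that are applied
afterwards are normal (`CPInstrument.hasSum_effect`). Separate additivity alone does not give a
measure on finite products; this is where the standard Borel assumption enters.

`IsCylinderPremeasure.exists_measure_cylinder` proves the extension. Code `Ω` by points of the
Cantor space and a sequence in `Ω` by a single sequence of bits, by means of `Nat.pair`. Each finite
string of bits then has a mass, and a consistent family of such masses is always a measure: it is
the law of the bits of a uniformly distributed real number under the subdivision of an interval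
into pieces of the prescribed lengths (`exists_measure_revPrefix`). This measure has the right
values on rectangles of clopen sets by finite additivity, and on rectangles of measurable sets by
the `π`-`λ` theorem, used in one coordinate at a time. A measurable left inverse of the code
carries it back to `ℕ → Ω`.

It remains to see that, for each measurable `A`, the function `ψ ↦ μ ψ A` is the quadratic form of a
positive operator (`exists_povm_of_measure`). This holds for cylinders and passes to complements
and to countable disjoint unions, since positive operators whose quadratic forms converge have a
weak limit (`exists_nonneg_of_tendsto_reApplyInnerSelf`). The uniqueness
(`POVM.ext_of_generateFrom`) is again the `π`-`λ` theorem.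
-/

open scoped ENNReal NNReal

section TreeMeasure

/-! ### Measures on the Cantor space from masses on the binary tree -/

/-- The first `m` bits of `x`, latest bit first. -/
def revPrefix (x : ℕ → Bool) : ℕ → List Bool
  | 0 => []
  | m + 1 => x m :: revPrefix x m

@[simp] lemma length_revPrefix (x : ℕ → Bool) (m : ℕ) : (revPrefix x m).length = m := by
  induction m with
  | zero => rfl
  | succ m ih => simp [revPrefix, ih]

/-- Every list is a reversed prefix, so that nodes of the binary tree may be studied through
infinite branches. -/
lemma exists_revPrefix_eq (l : List Bool) : ∃ x, revPrefix x l.length = l := by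
  refine ⟨fun i => l.reverse.getD i false, ?_⟩
  suffices h : ∀ m ≤ l.length, revPrefix (fun i => l.reverse.getD i false) m
      = (l.reverse.take m).reverse by
    have := h l.length le_rfl
    rwa [List.take_of_length_le (by simp), List.reverse_reverse] at this
  intro m hm
  induction m with
  | zero => simp [revPrefix]
  | succ m ih =>
    rw [revPrefix, ih (by omega), List.take_add_one]
    have : m < l.reverse.length := by simpa using hm
    simp [List.getD, List.getElem?_eq_getElem this]

lemma revPrefix_eq_iff {x y : ℕ → Bool} {m : ℕ} :
    revPrefix x m = revPrefix y m ↔ ∀ i < m, x i = y i := by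
  induction m with
  | zero => simp [revPrefix]
  | succ m ih =>
    simp only [revPrefix, List.cons.injEq, ih, Nat.lt_succ_iff_lt_or_eq]
    constructor
    · rintro ⟨h, h'⟩ i (hi | rfl)
      exacts [h' i hi, h]
    · exact fun h => ⟨h m (Or.inr rfl), fun i hi => h i (Or.inl hi)⟩

/-- Left end point of the interval attached to a node of the binary tree, when the interval of
each node is cut into that of its child `false` followed by that of its child `true`. -/
noncomputable def leftEnd (p : List Bool → ℝ≥0) : List Bool → ℝ
  | [] => 0
  | b :: l => leftEnd p l + if b then (p (false :: l) : ℝ) else 0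

/-- The node of depth `m` whose interval contains `u`, for `u` in the interval `[0, p [])` of the
root. -/
noncomputable def nodeAt (p : List Bool → ℝ≥0) (u : ℝ) : ℕ → List Bool
  | 0 => []
  | m + 1 => decide (leftEnd p (nodeAt p u m) + p (false :: nodeAt p u m) ≤ u) :: nodeAt p u m

lemma Ico_leftEnd_subset {p : List Bool → ℝ≥0} (hp : ∀ l, p l = p (true :: l) + p (false :: l))
    (l : List Bool) : Set.Ico (leftEnd p l) (leftEnd p l + p l) ⊆ Set.Ico 0 (p [] : ℝ) := by
  induction l with
  | nil => simp [leftEnd]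
  | cons b l ih =>
    have h := congrArg NNReal.toReal (hp l)
    push_cast at h
    have h1 := (p (true :: l)).coe_nonneg
    have h2 := (p (false :: l)).coe_nonneg
    refine subset_trans (Set.Ico_subset_Ico ?_ ?_) ih <;> cases b <;> simp [leftEnd] <;> linarith

/-- The points that reach the node `l` are exactly those of its interval. -/
lemma nodeAt_eq_iff {p : List Bool → ℝ≥0} (hp : ∀ l, p l = p (true :: l) + p (false :: l))
    {u : ℝ} (hu : u ∈ Set.Ico 0 (p [] : ℝ)) (l : List Bool) :
    nodeAt p u l.length = l ↔ u ∈ Set.Ico (leftEnd p l) (leftEnd p l + p l) := by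
  induction l with
  | nil => simpa [nodeAt, leftEnd] using hu
  | cons b l ih =>
    have h := congrArg NNReal.toReal (hp l)
    push_cast at h
    have h1 := (p (true :: l)).coe_nonneg
    have h2 := (p (false :: l)).coe_nonneg
    simp only [List.length_cons, nodeAt, List.cons.injEq, leftEnd]
    constructor
    · rintro ⟨hb, hl⟩
      have := ih.1 hl
      rw [hl] at hb
      rw [Set.mem_Ico] at this ⊢
      cases b
      · simp at hb ⊢; constructor <;> linarith
      · simp at hb ⊢; constructor <;> linarith
    · intro hb
      have hl : nodeAt p u l.length = l := by
        rw [ih]; rw [Set.mem_Ico] at hb ⊢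
        cases b <;> simp at hb <;> constructor <;> linarith
      refine ⟨?_, hl⟩
      rw [hl]
      cases b
      · simp at hb ⊢; linarith
      · simp at hb ⊢; linarith

/-- A consistent assignment of masses to the nodes of the binary tree is a measure on the Cantor
space: cut `[0, p [])` successively into intervals of the prescribed lengths and push Lebesgue
measure forward along the map that records which intervals a point lies in. -/
theorem exists_measure_revPrefix {p : List Bool → ℝ≥0}
    (hp : ∀ l, p l = p (true :: l) + p (false :: l)) :
    ∃ ν : Measure (ℕ → Bool), IsFiniteMeasure ν ∧
      ∀ l, ν {x | revPrefix x l.length = l} = p l := by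
  let _ : MeasurableSpace (List Bool) := ⊤
  have : DiscreteMeasurableSpace (List Bool) := ⟨fun _ => trivial⟩
  have hnode : ∀ m, Measurable fun u => nodeAt p u m := by
    intro m
    induction m with
    | zero => exact measurable_const
    | succ m ih =>
      have hs : MeasurableSet
          {u : ℝ | leftEnd p (nodeAt p u m) + p (false :: nodeAt p u m) ≤ u} :=
        measurableSet_le ((measurable_from_top
          (f := fun l => leftEnd p l + (p (false :: l) : ℝ))).comp ih) measurable_id
      have hb : Measurable fun u : ℝ =>
          decide (leftEnd p (nodeAt p u m) + p (false :: nodeAt p u m) ≤ u) :=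
        measurable_to_bool (by simpa [Set.preimage] using hs)
      exact (Measurable.of_discrete (f := fun q : Bool × List Bool => q.1 :: q.2)).comp
        (hb.prodMk ih)
  let x : ℝ → ℕ → Bool := fun u m => (nodeAt p u (m + 1)).headI
  have hx : Measurable x := measurable_pi_lambda _ fun m => 
    (measurable_from_top (f := List.headI)).comp (hnode (m + 1))
  have hxn : ∀ u m, revPrefix (x u) m = nodeAt p u m := by
    intro u m
    induction m with
    | zero => rfl
    | succ m ih => rw [revPrefix, ih]; rfl
  have : IsFiniteMeasure (volume.restrict (Set.Ico 0 (p [] : ℝ))) := ⟨by simp⟩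
  refine ⟨(volume.restrict (Set.Ico 0 (p [] : ℝ))).map x, inferInstance, fun l => ?_⟩
  have hmeas : MeasurableSet {y | revPrefix y l.length = l} := by
    obtain ⟨y, hy⟩ := exists_revPrefix_eq l
    rw [← hy]
    simp only [length_revPrefix, revPrefix_eq_iff, Set.ofPred_forall]
    exact .iInter fun i => .iInter fun _ => measurableSet_eq_fun (measurable_pi_apply i)
      measurable_const
  rw [Measure.map_apply hx hmeas, Measure.restrict_apply (hx hmeas)]
  have : x ⁻¹' {y | revPrefix y l.length = l} ∩ Set.Ico 0 (p [] : ℝ)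
      = Set.Ico (leftEnd p l) (leftEnd p l + p l) := by
    ext u
    simp only [Set.mem_inter_iff, Set.mem_preimage, Set.mem_ofPred_eq, hxn]
    exact ⟨fun h => (nodeAt_eq_iff hp h.2 l).1 h.1, fun h =>
      have h' := Ico_leftEnd_subset hp l h
      ⟨(nodeAt_eq_iff hp h' l).2 h, h'⟩⟩
  rw [this]
  simp

end TreeMeasure

section Extension

/-! ### Extension of separately countably additive set functions on cylinders -/

/-- A pre-measure on the cylinders of `ℕ → Ω`: `F n B` stands for the mass of
`B 0 × ⋯ × B (n - 1) × Ω × Ω × ⋯`. It is only required to be a measure in each coordinate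
separately. -/
structure IsCylinderPremeasure {Ω : Type*} [MeasurableSpace Ω]
    (F : ℕ → (ℕ → {B : Set Ω // MeasurableSet B}) → ℝ≥0∞) : Prop where
  congr : ∀ {n : ℕ} {B B' : ℕ → {B : Set Ω // MeasurableSet B}},
    (∀ i < n, B i = B' i) → F n B = F n B'
  succ_of_top : ∀ {n : ℕ} {B : ℕ → {B : Set Ω // MeasurableSet B}},
    B n = ⊤ → F (n + 1) B = F n B
  zero_ne_top : F 0 ⊤ ≠ ∞
  exists_measure : ∀ {n i : ℕ} (B : ℕ → {B : Set Ω // MeasurableSet B}), i < n →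
    ∃ m : Measure Ω, ∀ A : {B : Set Ω // MeasurableSet B}, m A = F n (Function.update B i A)

namespace IsCylinderPremeasure

variable {Ω : Type*} [MeasurableSpace Ω]
  {F : ℕ → (ℕ → {B : Set Ω // MeasurableSet B}) → ℝ≥0∞} (hF : IsCylinderPremeasure F)

include hF

lemma eq_of_le {n N : ℕ} (hnN : n ≤ N) {B : ℕ → {B : Set Ω // MeasurableSet B}}
    (hB : ∀ k, n ≤ k → B k = ⊤) : F N B = F n B := by
  induction N, hnN using Nat.le_induction with
  | base => rfl
  | succ N hN ih => rw [hF.succ_of_top (hB N hN), ih]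

lemma mono {n : ℕ} {B B' : ℕ → {B : Set Ω // MeasurableSet B}} (h : ∀ i, B i ≤ B' i) :
    F n B ≤ F n B' := by
  -- replace the coordinates one at a time
  have key : ∀ i ≤ n, F n B ≤ F n (fun k => if k < i then B' k else B k) := by
    intro i hi
    induction i with
    | zero => simp
    | succ i ih =>
      refine (ih (by omega)).trans ?_
      obtain ⟨m, hm⟩ := hF.exists_measure (fun k => if k < i then B' k else B k)
        (show i < n by omega)
      have h1 := hm (B i)
      have h2 := hm (B' i)
      rw [show (fun k => if k < i then B' k else B k) =
        Function.update (fun k => if k < i then B' k else B k) i (B i) by simp, ← h1,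
        show (fun k => if k < i + 1 then B' k else B k) =
        Function.update (fun k => if k < i then B' k else B k) i (B' i) by
          ext1 k
          rcases eq_or_ne k i with rfl | hk
          · simp
          · simp only [Function.update_of_ne hk]
            congr 1
            simp only [eq_iff_iff]; omega, ← h2]
      exact measure_mono (h i)
  refine (key n le_rfl).trans_eq (hF.congr fun i hi => by simp [hi])

lemma ne_top (n : ℕ) (B : ℕ → {B : Set Ω // MeasurableSet B}) : F n B ≠ ∞ := by
  refine ne_top_of_le_ne_top hF.zero_ne_top ((hF.mono fun i => le_top).trans_eq ?_)
  exact hF.eq_of_le (Nat.zero_le n) (fun _ _ => rfl)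

lemma eq_zero_of_bot {n i : ℕ} (hi : i < n) {B : ℕ → {B : Set Ω // MeasurableSet B}}
    (hB : B i = ⊥) : F n B = 0 := by
  obtain ⟨m, hm⟩ := hF.exists_measure B hi
  rw [← Function.update_eq_self i B, hB, ← hm]
  exact measure_empty

lemma eq_add_of_split {n i : ℕ} (hi : i < n) (B : ℕ → {B : Set Ω // MeasurableSet B})
    (S : {B : Set Ω // MeasurableSet B}) :
    F n B = F n (Function.update B i (B i ⊓ S)) + F n (Function.update B i (B i ⊓ Sᶜ)) := by
  obtain ⟨m, hm⟩ := hF.exists_measure B hi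
  rw [← hm, ← hm]
  conv_lhs => rw [← Function.update_eq_self i B, ← hm]
  exact (measure_inter_add_sdiff _ S.2).symm

end IsCylinderPremeasure

/-- The preimage of a measurable set under a measurable map. -/
def measurablePreimage {α β : Type*} [MeasurableSpace α] [MeasurableSpace β] {e : α → β}
    (he : Measurable e) (C : {C : Set β // MeasurableSet C}) : {B : Set α // MeasurableSet B} :=
  ⟨e ⁻¹' C, he C.2⟩

/-- The set of points of the Cantor space whose `j`-th bit is `b`. -/
def bitSet (j : ℕ) (b : Bool) : {C : Set (ℕ → Bool) // MeasurableSet C} :=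
  ⟨{z | z j = b}, measurableSet_eq_fun (measurable_pi_apply j) measurable_const⟩

/-- The bits of `x`, arranged as a sequence of points of the Cantor space. -/
def rows (x : ℕ → Bool) (k j : ℕ) : Bool := x (Nat.pair k j)

lemma measurable_rows (k : ℕ) : Measurable fun x => rows x k :=
  measurable_pi_lambda _ fun _ => measurable_pi_apply _

variable {Ω : Type*} [MeasurableSpace Ω]

/-- For a code `e` of `Ω` in the Cantor space, the box in `ℕ → Ω` of the sequences whose bits,
listed in the order given by `Nat.pair`, begin with `l` (in reverse). -/
def bitBox {e : Ω → ℕ → Bool} (he : Measurable e) :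
    List Bool → ℕ → {B : Set Ω // MeasurableSet B}
  | [] => ⊤
  | b :: l => Function.update (bitBox he l) l.length.unpair.1
      (bitBox he l l.length.unpair.1 ⊓ measurablePreimage he (bitSet l.length.unpair.2 b))

variable {e : Ω → ℕ → Bool} (he : Measurable e)

/-- The recursive definition of `bitBox` in closed form: the `k`-th factor fixes the bits `j` with
`Nat.pair k j` below the length of the prefix. -/
lemma mem_bitBox_revPrefix (x : ℕ → Bool) (m k : ℕ) (ω : Ω) :
    ω ∈ (bitBox he (revPrefix x m) k : Set Ω) ↔
      ∀ j, Nat.pair k j < m → e ω j = rows x k j := by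
  induction m with
  | zero => simp [revPrefix, bitBox]
  | succ m ih =>
    rw [revPrefix, bitBox, length_revPrefix]
    have key : (∀ j, Nat.pair k j < m + 1 → e ω j = rows x k j) ↔
        (∀ j, Nat.pair k j < m → e ω j = rows x k j) ∧
          (k = m.unpair.1 → e ω m.unpair.2 = x m) := by
      constructor
      · refine fun h => ⟨fun j hj => h j (by omega), ?_⟩
        rintro rfl
        simpa [rows] using h m.unpair.2 (by simp)
      · rintro ⟨h, h'⟩ j hj
        rcases Nat.lt_succ_iff_lt_or_eq.1 hj with hj | rfl
        · exact h j hj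
        · simpa [rows] using h' (by simp)
    rw [key, ← ih]
    rcases eq_or_ne k m.unpair.1 with rfl | hk
    · simp only [Function.update_self, forall_const]
      rfl
    · simp [hk]

lemma bitBox_eq_top {l : List Bool} {k : ℕ} (h : l.length ≤ k) : bitBox he l k = ⊤ := by
  obtain ⟨x, hx⟩ := exists_revPrefix_eq l
  rw [← hx]
  ext ω
  simp only [mem_bitBox_revPrefix]
  refine iff_of_true (fun j hj => ?_) trivial
  have := Nat.left_le_pair k j
  omega

/-- Fixing one more bit splits the mass, since only one coordinate of the box is cut. -/
lemma IsCylinderPremeasure.bitBox_cons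
    {F : ℕ → (ℕ → {B : Set Ω // MeasurableSet B}) → ℝ≥0∞} (hF : IsCylinderPremeasure F)
    {N : ℕ} (l : List Bool) (hN : l.length < N) (D : ℕ → {B : Set Ω // MeasurableSet B}) :
    F N (fun k => bitBox he l k ⊓ D k) =
      F N (fun k => bitBox he (true :: l) k ⊓ D k) +
      F N (fun k => bitBox he (false :: l) k ⊓ D k) := by
  have hk : l.length.unpair.1 < N := (Nat.unpair_left_le _).trans_lt hN
  rw [hF.eq_add_of_split hk _ (measurablePreimage he (bitSet l.length.unpair.2 true))]
  congr 2 <;>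
  · funext k
    rcases eq_or_ne k l.length.unpair.1 with rfl | hk
    · ext ω
      simp [bitBox, measurablePreimage, bitSet]
      tauto
    · simp [bitBox, Function.update_of_ne hk]

/-- Masses of rectangles of clopen sets in the coded space: split the bits one at a time until
the first `L` of them, which decide membership in the rectangle, are fixed. -/
lemma IsCylinderPremeasure.measure_rows_of_determined
    {F : ℕ → (ℕ → {B : Set Ω // MeasurableSet B}) → ℝ≥0∞} (hF : IsCylinderPremeasure F)
    {ν : Measure (ℕ → Bool)}
    (hν : ∀ l, ν {x | revPrefix x l.length = l} = F l.length (bitBox he l))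
    {L N : ℕ} (hLN : L ≤ N) (C : ℕ → {C : Set (ℕ → Bool) // MeasurableSet C})
    (hC : ∀ k z z', (∀ j, Nat.pair k j < L → z j = z' j) →
      (z ∈ (C k : Set (ℕ → Bool)) ↔ z' ∈ (C k : Set (ℕ → Bool)))) :
    ν {x | ∀ k < N, rows x k ∈ (C k : Set (ℕ → Bool))} =
      F N (fun k => measurablePreimage he (C k)) := by
  suffices H : ∀ d (l : List Bool), l.length + d = L →
      ν ({x | revPrefix x l.length = l} ∩ {x | ∀ k < N, rows x k ∈ (C k : Set (ℕ → Bool))}) =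
        F N (fun k => bitBox he l k ⊓ measurablePreimage he (C k)) by
    simpa [revPrefix, bitBox] using H L [] (by simp)
  intro d
  induction d with
  | zero =>
    intro l hl
    simp only [Nat.add_zero] at hl
    obtain ⟨x, hx⟩ := exists_revPrefix_eq l
    have hrow : ∀ y, revPrefix y l.length = l → ∀ k,
        (rows y k ∈ (C k : Set (ℕ → Bool)) ↔ rows x k ∈ (C k : Set (ℕ → Bool))) := by
      intro y hy k
      refine hC k _ _ fun j hj => ?_
      exact revPrefix_eq_iff.1 (hy.trans hx.symm) _ (by omega)
    have hbox : ∀ k ω, ω ∈ (bitBox he l k : Set Ω) →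
        (e ω ∈ (C k : Set (ℕ → Bool)) ↔ rows x k ∈ (C k : Set (ℕ → Bool))) := by
      intro k ω hω
      rw [← hx, mem_bitBox_revPrefix, hl] at hω
      exact hC k _ _ hω
    by_cases h : ∀ k < N, rows x k ∈ (C k : Set (ℕ → Bool))
    · have h1 : {x | revPrefix x l.length = l} ∩
          {x | ∀ k < N, rows x k ∈ (C k : Set (ℕ → Bool))} = {x | revPrefix x l.length = l} :=
        Set.inter_eq_left.2 fun y hy k hk => (hrow y hy k).2 (h k hk)
      rw [h1, hν, ← hF.eq_of_le (hl.trans_le hLN) fun k hk => bitBox_eq_top he hk]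
      exact hF.congr fun k hk => Eq.symm <| inf_eq_left.2 fun ω hω => (hbox k ω hω).2 (h k hk)
    · push Not at h
      obtain ⟨k, hk, hxk⟩ := h
      rw [hF.eq_zero_of_bot hk]
      · have : {x | revPrefix x l.length = l} ∩
            {x | ∀ k < N, rows x k ∈ (C k : Set (ℕ → Bool))} = ∅ :=
          Set.eq_empty_of_forall_notMem fun y hy => hxk ((hrow y hy.1 k).1 (hy.2 k hk))
        rw [this, measure_empty]
      · exact eq_bot_iff.2 fun ω hω => hxk ((hbox k ω hω.1).1 hω.2)
  | succ d ih =>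
    intro l hl
    rw [hF.bitBox_cons he l (by omega), ← ih (true :: l) (by simp; omega),
      ← ih (false :: l) (by simp; omega),
      ← measure_inter_add_sdiff _ (bitSet l.length true).2]
    congr 2 <;>
    · ext x
      simp [revPrefix, bitSet]
      tauto

/-- A set of points of the Cantor space is finitely determined if membership depends on finitely
many bits only. -/
def IsFinitelyDetermined (C : Set (ℕ → Bool)) : Prop :=
  ∃ M, ∀ z z' : ℕ → Bool, (∀ j < M, z j = z' j) → (z ∈ C ↔ z' ∈ C)

lemma isPiSystem_isFinitelyDetermined :
    IsPiSystem {C : Set (ℕ → Bool) | MeasurableSet C ∧ IsFinitelyDetermined C} := by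
  rintro C ⟨hC, M, hM⟩ D ⟨hD, M', hM'⟩ -
  refine ⟨hC.inter hD, max M M', fun z z' h => and_congr (hM z z' fun j hj => h j ?_)
    (hM' z z' fun j hj => h j ?_)⟩
  exacts [lt_max_of_lt_left hj, lt_max_of_lt_right hj]

lemma generateFrom_isFinitelyDetermined :
    (MeasurableSpace.pi : MeasurableSpace (ℕ → Bool)) = MeasurableSpace.generateFrom
      {C : Set (ℕ → Bool) | MeasurableSet C ∧ IsFinitelyDetermined C} := by
  refine le_antisymm (iSup_le fun j => ?_) (MeasurableSpace.generateFrom_le fun C hC => hC.1)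
  rintro _ ⟨t, ht, rfl⟩
  refine MeasurableSpace.measurableSet_generateFrom ⟨measurable_pi_apply j ht, j + 1, ?_⟩
  intro z z' h
  simp [h j (by omega)]

/-- Masses of rectangles of arbitrary measurable sets in the coded space, by the `π`-`λ` theorem in
one coordinate after the other; both sides are measures in each coordinate. -/
lemma IsCylinderPremeasure.measure_rows
    {F : ℕ → (ℕ → {B : Set Ω // MeasurableSet B}) → ℝ≥0∞} (hF : IsCylinderPremeasure F)
    {ν : Measure (ℕ → Bool)} [IsFiniteMeasure ν]
    (hν : ∀ l, ν {x | revPrefix x l.length = l} = F l.length (bitBox he l))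
    (n : ℕ) (C : ℕ → {C : Set (ℕ → Bool) // MeasurableSet C}) :
    ν {x | ∀ k < n, rows x k ∈ (C k : Set (ℕ → Bool))} =
      F n (fun k => measurablePreimage he (C k)) := by
  -- allow arbitrary measurable sets in the first `i` coordinates, one coordinate at a time
  suffices H : ∀ i ≤ n, ∀ C : ℕ → {C : Set (ℕ → Bool) // MeasurableSet C},
      (∀ k, i ≤ k → k < n → IsFinitelyDetermined (C k)) →
      ν {x | ∀ k < n, rows x k ∈ (C k : Set (ℕ → Bool))} =
        F n (fun k => measurablePreimage he (C k)) from
    H n le_rfl C fun k hk hk' => absurd hk hk'.not_ge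
  intro i hi
  induction i with
  | zero =>
    intro C hC
    choose! M hM using fun k (hk : k < n) => hC k (Nat.zero_le k) hk
    -- the bits `j < M'` of the rows `k < n` all have index below `Nat.pair n M'`
    obtain ⟨M', hM'⟩ : ∃ M', ∀ k < n, M k ≤ M' :=
      ⟨(Finset.range n).sup M, fun k hk => Finset.le_sup (Finset.mem_range.2 hk)⟩
    let C' : ℕ → {C : Set (ℕ → Bool) // MeasurableSet C} := fun k => if k < n then C k else ⊤
    have key := hF.measure_rows_of_determined he hν (le_refl (Nat.pair n M')) C' ?_
    · have h1 : {x | ∀ k < Nat.pair n M', rows x k ∈ (C' k : Set (ℕ → Bool))} =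
          {x | ∀ k < n, rows x k ∈ (C k : Set (ℕ → Bool))} := by
        ext x
        constructor
        · intro h k hk
          simpa [C', hk] using h k (hk.trans_le (Nat.left_le_pair _ _))
        · intro h k _
          by_cases hk : k < n
          · simpa [C', hk] using h k hk
          · simp [C', hk]
      rw [← h1, key, hF.eq_of_le (Nat.left_le_pair n M') fun k hk => ?_]
      · exact hF.congr fun k hk => by simp [C', hk]
      · simp [C', hk.not_gt]; rfl
    · intro k z z' h
      by_cases hk : k < n
      · simp only [C', hk, if_true]
        refine hM k hk z z' fun j hj => h j ?_
        exact Nat.pair_lt_pair_left _ hk |>.trans_le <|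
          (Nat.pair_lt_pair_right n (hj.trans_le (hM' k hk))).le
      · simp [C', hk]
  | succ i ih =>
    intro C hC
    obtain ⟨m, hm⟩ := hF.exists_measure (fun k => measurablePreimage he (C k))
      (show i < n by omega)
    let S : Set (ℕ → Bool) := {x | ∀ k < n, k ≠ i → rows x k ∈ (C k : Set (ℕ → Bool))}
    have hS : MeasurableSet S := by
      simp only [S, Set.ofPred_forall]
      exact .iInter fun k => .iInter fun _ => .iInter fun _ => measurable_rows k (C k).2
    have hm' : ∀ D : {C : Set (ℕ → Bool) // MeasurableSet C}, m.map e D =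
        F n (fun k => measurablePreimage he (Function.update C i D k)) := by
      intro D
      rw [Measure.map_apply he D.2]
      refine (hm (measurablePreimage he D)).trans (congrArg _ ?_)
      funext k
      rcases eq_or_ne k i with rfl | hk
      · simp
      · simp [Function.update_of_ne hk]
    have hν' : ∀ D : {C : Set (ℕ → Bool) // MeasurableSet C},
        (ν.restrict S).map (fun x => rows x i) D =
          ν {x | ∀ k < n, rows x k ∈ (Function.update C i D k : Set (ℕ → Bool))} := by
      intro D
      rw [Measure.map_apply (measurable_rows i) D.2,
        Measure.restrict_apply (measurable_rows i D.2)]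
      congr 1
      ext x
      constructor
      · rintro ⟨h, h'⟩ k hk
        rcases eq_or_ne k i with rfl | hki
        · simpa using h
        · simpa [Function.update_of_ne hki] using h' k hk hki
      · intro h
        refine ⟨by simpa using h i (by omega), fun k hk hki => ?_⟩
        simpa [Function.update_of_ne hki] using h k hk
    have heq : ∀ D : {C : Set (ℕ → Bool) // MeasurableSet C}, IsFinitelyDetermined D →
        (ν.restrict S).map (fun x => rows x i) D = m.map e D := by
      intro D hD
      rw [hm', hν']
      refine ih (by omega) _ fun k hk hk' => ?_
      rcases eq_or_ne k i with rfl | hki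
      · simpa using hD
      · simpa [Function.update_of_ne hki] using hC k (by omega) hk'
    have hext : (ν.restrict S).map (fun x => rows x i) = m.map e :=
      ext_of_generate_finite _ generateFrom_isFinitelyDetermined isPiSystem_isFinitelyDetermined
        (fun D hD => heq ⟨D, hD.1⟩ hD.2) (heq ⊤ ⟨0, fun _ _ _ => Iff.rfl⟩)
    have := hν' (C i)
    rw [hext, hm' (C i)] at this
    simpa using this.symm

/-- On a standard Borel space, a pre-measure on cylinders extends to a measure. A measurable left
inverse `g` of the code `e` carries the measure back from the Cantor space, so that the range of
`e` need not be considered. -/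
theorem IsCylinderPremeasure.exists_measure_cylinder [StandardBorelSpace Ω]
    {F : ℕ → (ℕ → {B : Set Ω // MeasurableSet B}) → ℝ≥0∞} (hF : IsCylinderPremeasure F) :
    ∃ μ : Measure (ℕ → Ω), IsFiniteMeasure μ ∧
      ∀ n B, μ {ω | ∀ k < n, ω k ∈ (B k : Set Ω)} = F n B := by
  rcases isEmpty_or_nonempty Ω with hΩ | hΩ
  · refine ⟨0, inferInstance, fun n B => ?_⟩
    -- on an empty space the total mass `F 1 ⊤` is `F 1 ⊥ = 0`
    have h0 : F 0 ⊤ = 0 := by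
      rw [← hF.succ_of_top (n := 0) rfl]
      exact hF.eq_zero_of_bot one_pos (Subsingleton.elim _ _)
    have h1 : F n B ≤ F 0 ⊤ :=
      (hF.mono fun i => le_top).trans_eq (hF.eq_of_le (Nat.zero_le n) fun _ _ => rfl)
    simpa using (le_zero_iff.1 (h1.trans_eq h0)).symm
  obtain ⟨e, he, g, hg, hge⟩ : ∃ e : Ω → ℕ → Bool, Measurable e ∧
      ∃ g : (ℕ → Bool) → Ω, Measurable g ∧ ∀ ω, g (e ω) = ω := by
    have hemb := (PolishSpace.measurableEquivNatBoolOfNotCountable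
      (α := ℝ) not_countable).measurableEmbedding.comp
      (measurableEmbedding_embeddingReal Ω)
    obtain ⟨g, hg, hge⟩ := hemb.exists_measurable_extend measurable_id fun _ => inferInstance
    exact ⟨_, hemb.measurable, g, hg, congrFun hge⟩
  have hp : ∀ l, (F l.length (bitBox he l)).toNNReal =
      (F (true :: l).length (bitBox he (true :: l))).toNNReal +
      (F (false :: l).length (bitBox he (false :: l))).toNNReal := by
    intro l
    rw [← ENNReal.toNNReal_add (hF.ne_top _ _) (hF.ne_top _ _)]
    congr 1
    have := hF.bitBox_cons he l l.length.lt_succ_self ⊤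
    simp only [Pi.top_apply, inf_top_eq] at this
    rw [← hF.succ_of_top (bitBox_eq_top he le_rfl)]
    exact this
  obtain ⟨ν, hfin, hν⟩ := exists_measure_revPrefix hp
  simp only [ENNReal.coe_toNNReal (hF.ne_top _ _)] at hν
  have hmeas : Measurable fun x k => g (rows x k) :=
    measurable_pi_lambda _ fun k => hg.comp (measurable_rows k)
  refine ⟨ν.map fun x k => g (rows x k), inferInstance, fun n B => ?_⟩
  rw [Measure.map_apply hmeas]
  · refine (hF.measure_rows he hν n fun k => measurablePreimage hg (B k)).trans
      (congrArg _ (funext fun k => Subtype.ext ?_))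
    ext ω
    simp [measurablePreimage, hge]
  · simp only [Set.ofPred_forall]
    exact .iInter fun k => .iInter fun _ => measurable_pi_apply k (B k).2

end Extension

section Operators

/-! ### Quadratic forms and weak limits of positive operators -/

open Filter Topology

variable {H : Type*} [NormedAddCommGroup H] [InnerProductSpace ℂ H]

lemma ContinuousLinearMap.coe_reApplyInnerSelf_of_nonneg {T : H →L[ℂ] H} (hT : 0 ≤ T) (ψ : H) :
    (T.reApplyInnerSelf ψ : ℂ) = inner ℂ (T ψ) ψ :=
  ((nonneg_iff_isPositive T).1 hT).isSymmetric.coe_reApplyInnerSelf_apply ψ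

lemma ContinuousLinearMap.reApplyInnerSelf_nonneg {T : H →L[ℂ] H} (hT : 0 ≤ T) (ψ : H) :
    0 ≤ T.reApplyInnerSelf ψ :=
  ((nonneg_iff_isPositive T).1 hT).2 ψ

lemma ContinuousLinearMap.reApplyInnerSelf_sub (S T : H →L[ℂ] H) (ψ : H) :
    (S - T).reApplyInnerSelf ψ = S.reApplyInnerSelf ψ - T.reApplyInnerSelf ψ := by
  simp [reApplyInnerSelf_apply, inner_sub_left]

lemma ContinuousLinearMap.reApplyInnerSelf_sum {ι : Type*} (s : Finset ι) (T : ι → H →L[ℂ] H)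
    (ψ : H) : (∑ i ∈ s, T i).reApplyInnerSelf ψ = ∑ i ∈ s, (T i).reApplyInnerSelf ψ := by
  simp [reApplyInnerSelf_apply, sum_apply, sum_inner]

lemma ContinuousLinearMap.eq_of_reApplyInnerSelf_eq {S T : H →L[ℂ] H} (hS : 0 ≤ S) (hT : 0 ≤ T)
    (h : ∀ ψ, S.reApplyInnerSelf ψ = T.reApplyInnerSelf ψ) : S = T := by
  refine ContinuousLinearMap.coe_inj.1 ((ext_inner_map (S : H →ₗ[ℂ] H) T).1 fun ψ => ?_)
  simp only [coe_coe, ← coe_reApplyInnerSelf_of_nonneg hS, ← coe_reApplyInnerSelf_of_nonneg hT, h]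

variable [CompleteSpace H]

omit [CompleteSpace H] in
/-- By polarization, convergence of the quadratic forms of positive operators is weak
convergence. -/
lemma tendsto_inner_of_tendsto_reApplyInnerSelf {ι : Type*} {f : Filter ι} {T : ι → H →L[ℂ] H}
    (hT : ∀ i, 0 ≤ T i) {q : H → ℝ}
    (h : ∀ ψ, Tendsto (fun i => (T i).reApplyInnerSelf ψ) f (𝓝 (q ψ))) (ψ φ : H) :
    Tendsto (fun i => inner ℂ (T i ψ) φ) f (𝓝 ((q (φ + ψ) - q (φ - ψ) +
      Complex.I * q (φ + Complex.I • ψ) - Complex.I * q (φ - Complex.I • ψ)) / 4)) := by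
  have h' : ∀ ψ, Tendsto (fun i => inner ℂ ((T i : H →ₗ[ℂ] H) ψ) ψ) f (𝓝 (q ψ : ℂ)) := by
    intro ψ
    simp only [ContinuousLinearMap.coe_coe,
      ← ContinuousLinearMap.coe_reApplyInnerSelf_of_nonneg (hT _)]
    exact (Complex.continuous_ofReal.tendsto _).comp (h ψ)
  have := ((((h' (φ + ψ)).sub (h' (φ - ψ))).add
    ((h' (φ + Complex.I • ψ)).const_mul Complex.I)).sub
    ((h' (φ - Complex.I • ψ)).const_mul Complex.I)).div_const 4
  refine this.congr fun i => ?_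
  exact (inner_map_polarization (T i : H →ₗ[ℂ] H) φ ψ).symm

lemma tendsto_ofCLM_of_tendsto_reApplyInnerSelf {ι : Type*} {f : Filter ι} {T : ι → H →L[ℂ] H}
    (hT : ∀ i, 0 ≤ T i) {S : H →L[ℂ] H} (hS : 0 ≤ S)
    (h : ∀ ψ, Tendsto (fun i => (T i).reApplyInnerSelf ψ) f (𝓝 (S.reApplyInnerSelf ψ))) :
    Tendsto (fun i => ContinuousLinearMapWOT.ofCLM (T i)) f
      (𝓝 (ContinuousLinearMapWOT.ofCLM S : H →WOT[ℂ] H)) := by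
  refine ContinuousLinearMapWOT.tendsto_iff_forall_inner_apply_tendsto.2 fun ψ φ => ?_
  have h1 := tendsto_inner_of_tendsto_reApplyInnerSelf hT h ψ φ
  have h2 := tendsto_inner_of_tendsto_reApplyInnerSelf (T := fun _ : ℕ => S) (f := atTop)
    (fun _ => hS) (fun _ => tendsto_const_nhds) ψ φ
  rw [tendsto_nhds_unique h2 tendsto_const_nhds] at h1
  simpa [Function.comp_def] using (Complex.continuous_conj.tendsto _).comp h1

/-- Positive operators whose quadratic forms converge pointwise have a weak limit: the limiting
sesquilinear form is bounded by the uniform boundedness principle, and the operator that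
represents it is symmetric and everywhere defined, hence bounded. -/
lemma exists_nonneg_of_tendsto_reApplyInnerSelf {T : ℕ → H →L[ℂ] H} (hT : ∀ i, 0 ≤ T i) {q : H → ℝ}
    (h : ∀ ψ, Tendsto (fun i => (T i).reApplyInnerSelf ψ) atTop (𝓝 (q ψ))) :
    ∃ S : H →L[ℂ] H, 0 ≤ S ∧ ∀ ψ, S.reApplyInnerSelf ψ = q ψ := by
  have hlim : ∀ ψ : H, ∃ v : H, ∀ φ, Tendsto (fun i => inner ℂ (T i ψ) φ) atTop
      (𝓝 (inner ℂ v φ)) := by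
    intro ψ
    have ht : Tendsto (fun i φ => innerSL ℂ (T i ψ) φ) atTop (𝓝 _) :=
      tendsto_pi_nhds.2 fun φ => tendsto_inner_of_tendsto_reApplyInnerSelf hT h ψ φ
    refine ⟨(InnerProductSpace.toDual ℂ H).symm (continuousLinearMapOfTendsto _ ht), fun φ => ?_⟩
    rw [InnerProductSpace.toDual_symm_apply]
    exact tendsto_pi_nhds.1 ht φ
  choose S hS using hlim
  let S' : H →ₗ[ℂ] H :=
    { toFun := S
      map_add' := fun ψ ψ' => ext_inner_right ℂ fun φ =>
        tendsto_nhds_unique (hS (ψ + ψ') φ) <| by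
          simpa [inner_add_left] using (hS ψ φ).add (hS ψ' φ)
      map_smul' := fun c ψ => ext_inner_right ℂ fun φ =>
        tendsto_nhds_unique (hS (c • ψ) φ) <| by
          simpa [inner_smul_left, mul_comm] using (hS ψ φ).const_mul ((starRingEnd ℂ) c) }
  have hsymm : S'.IsSymmetric := by
    intro ψ φ
    have h1 := hS φ ψ
    have h2 := (Complex.continuous_conj.tendsto _).comp h1
    simp only [inner_conj_symm] at h2
    refine tendsto_nhds_unique (hS ψ φ) (h2.congr fun i => ?_)
    simp only [Function.comp, inner_conj_symm]
    exact (((ContinuousLinearMap.nonneg_iff_isPositive (T i)).1 (hT i)).isSymmetric ψ φ).symm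
  let R : H →L[ℂ] H := ⟨S', hsymm.continuous⟩
  have hR : ∀ ψ, R.reApplyInnerSelf ψ = q ψ := fun ψ =>
    tendsto_nhds_unique ((Complex.continuous_re.tendsto _).comp (hS ψ ψ)) (h ψ)
  refine ⟨R, (ContinuousLinearMap.nonneg_iff_isPositive R).2 ⟨hsymm, fun ψ => ?_⟩, hR⟩
  rw [hR]
  exact ge_of_tendsto' (h ψ) fun i => ContinuousLinearMap.reApplyInnerSelf_nonneg (hT i) ψ

end Operators

section POVM

/-! ### Positive operator valued measures and generating `π`-systems -/

lemma hasSum_measureReal_iUnion {X : Type*} [MeasurableSpace X] {μ : Measure X}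
    [IsFiniteMeasure μ] {A : ℕ → Set X} (hd : Pairwise (Function.onFun Disjoint A))
    (hA : ∀ i, MeasurableSet (A i)) :
    HasSum (fun i => μ.real (A i)) (μ.real (⋃ i, A i)) := by
  have h := measure_iUnion (μ := μ) hd hA
  rw [measureReal_def, h, ENNReal.tsum_toReal_eq fun i => measure_ne_top μ _]
  exact ENNReal.hasSum_toReal (h ▸ measure_ne_top μ _)

open Filter Topology

variable {X : Type*} [MeasurableSpace X]
  {H : Type*} [NormedAddCommGroup H] [InnerProductSpace ℂ H] [CompleteSpace H]

/-- A family of measures `μ ψ` that on a generating `π`-system is given by quadratic forms of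
positive operators comes from a positive operator valued measure. -/
theorem exists_povm_of_measure {𝒞 : Set (Set X)}
    (hgen : ‹MeasurableSpace X› = MeasurableSpace.generateFrom 𝒞) (hpi : IsPiSystem 𝒞)
    {μ : H → Measure X} [∀ ψ, IsFiniteMeasure (μ ψ)] (huniv : ∀ ψ, (μ ψ).real .univ = ‖ψ‖ ^ 2)
    (hμ : ∀ A ∈ 𝒞, ∃ T : H →L[ℂ] H, 0 ≤ T ∧ ∀ ψ, T.reApplyInnerSelf ψ = (μ ψ).real A) :
    ∃ E : POVM X H, ∀ A, MeasurableSet A → ∀ ψ, (E.eval A).reApplyInnerSelf ψ = (μ ψ).real A := by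
  have hone : ∀ ψ : H, (1 : H →L[ℂ] H).reApplyInnerSelf ψ = (μ ψ).real .univ := by
    intro ψ
    rw [huniv]
    simpa [ContinuousLinearMap.reApplyInnerSelf_apply] using inner_self_eq_norm_sq (𝕜 := ℂ) ψ
  have hex : ∀ A, MeasurableSet A →
      ∃ T : H →L[ℂ] H, 0 ≤ T ∧ ∀ ψ, T.reApplyInnerSelf ψ = (μ ψ).real A := by
    refine MeasurableSpace.induction_on_inter hgen hpi ?_ hμ ?_ ?_
    · exact ⟨0, le_rfl, fun ψ => by simp [ContinuousLinearMap.reApplyInnerSelf_apply]⟩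
    · rintro A hA ⟨T, hT, hTμ⟩
      have h : ∀ ψ, (1 - T).reApplyInnerSelf ψ = (μ ψ).real Aᶜ := fun ψ => by
        rw [ContinuousLinearMap.reApplyInnerSelf_sub, hone, hTμ, measureReal_compl hA]
      refine ⟨1 - T, (ContinuousLinearMap.nonneg_iff_isPositive _).2 ⟨?_, fun ψ => ?_⟩, h⟩
      · exact LinearMap.IsSymmetric.sub (fun _ _ => rfl)
          ((ContinuousLinearMap.nonneg_iff_isPositive T).1 hT).isSymmetric
      · rw [h]
        exact measureReal_nonneg
    · intro A hd hA hT
      choose T hT hTμ using hT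
      refine exists_nonneg_of_tendsto_reApplyInnerSelf
        (T := fun n => ∑ i ∈ Finset.range n, T i) (fun n => Finset.sum_nonneg fun i _ => hT i) ?_
      intro ψ
      simp only [ContinuousLinearMap.reApplyInnerSelf_sum, hTμ]
      exact (hasSum_measureReal_iUnion hd hA).tendsto_sum_nat
  classical
  choose! T hT hTμ using hex
  have hw : ∀ (A : ℕ → Set X), (∀ i, MeasurableSet (A i)) → Pairwise (Function.onFun Disjoint A) →
      HasSum (fun i => ContinuousLinearMapWOT.ofCLM (T (A i)))
        (ContinuousLinearMapWOT.ofCLM (σ := RingHom.id ℂ) (T (⋃ i, A i))) := by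
    intro A hA hd
    have : Tendsto (fun s : Finset ℕ => ContinuousLinearMapWOT.ofCLM (∑ i ∈ s, T (A i))) atTop
        (𝓝 (ContinuousLinearMapWOT.ofCLM (T (⋃ i, A i)) : H →WOT[ℂ] H)) := by
      refine tendsto_ofCLM_of_tendsto_reApplyInnerSelf
        (fun s => Finset.sum_nonneg fun i _ => hT _ (hA i)) (hT _ (.iUnion hA)) fun ψ => ?_
      simp only [ContinuousLinearMap.reApplyInnerSelf_sum, hTμ _ (hA _), hTμ _ (.iUnion hA)]
      exact hasSum_measureReal_iUnion hd hA
    refine this.congr fun s => ?_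
    exact map_sum (ContinuousLinearMapWOT.addEquiv (σ := RingHom.id ℂ) (E := H) (F := H)).symm _ s
  have hempty : T ∅ = 0 := by
    refine ContinuousLinearMap.eq_of_reApplyInnerSelf_eq (hT _ .empty) le_rfl fun ψ => ?_
    simp [hTμ _ .empty, ContinuousLinearMap.reApplyInnerSelf_apply]
  let V : VectorMeasure X (H →WOT[ℂ] H) :=
    { measureOf' := fun A => if MeasurableSet A then .ofCLM (T A) else 0
      empty' := by simp [hempty]
      not_measurable' := fun A hA => if_neg hA
      m_iUnion' := fun A hA hd => by simpa [hA, MeasurableSet.iUnion hA] using hw A hA hd }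
  have hV : ∀ A, MeasurableSet A → (V A).toCLM = T A := fun A hA =>
    congrArg ContinuousLinearMapWOT.toCLM (if_pos hA)
  refine ⟨⟨V, fun A hA => (hV A hA).symm ▸ hT A hA, ?_⟩, fun A hA ψ => ?_⟩
  · rw [hV _ .univ]
    exact ContinuousLinearMap.eq_of_reApplyInnerSelf_eq (hT _ .univ) zero_le_one fun ψ => by
      rw [hTμ _ .univ, hone]
  · rw [← hTμ A hA, ← hV A hA]
    rfl

/-- Two positive operator valued measures agree if they agree on a generating `π`-system. -/
theorem POVM.ext_of_generateFrom {𝒞 : Set (Set X)}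
    (hgen : ‹MeasurableSpace X› = MeasurableSpace.generateFrom 𝒞) (hpi : IsPiSystem 𝒞)
    {E E' : POVM X H} (h : ∀ A ∈ 𝒞, E.eval A = E'.eval A) : E = E' := by
  have hcompl : ∀ (E : POVM X H) A, MeasurableSet A →
      E.toVectorMeasure Aᶜ = E.toVectorMeasure .univ - E.toVectorMeasure A := by
    intro E A hA
    rw [eq_sub_iff_add_eq', ← VectorMeasure.of_union disjoint_compl_right hA hA.compl,
      Set.union_compl_self]
  have hV : E.toVectorMeasure = E'.toVectorMeasure := by
    refine VectorMeasure.ext fun A hA => ?_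
    induction A, hA using MeasurableSpace.induction_on_inter hgen hpi with
    | empty => simp
    | basic A hA => exact ContinuousLinearMapWOT.toCLM_injective (h A hA)
    | compl A hA ih =>
      rw [hcompl E A hA, hcompl E' A hA, ih,
        ContinuousLinearMapWOT.toCLM_injective (E.univ.trans E'.univ.symm)]
    | iUnion A hd hA ih =>
      refine (E.toVectorMeasure.m_iUnion hA hd).unique ?_
      simpa only [ih] using E'.toVectorMeasure.m_iUnion hA hd
  cases E
  cases E'
  simpa using hV

end POVM

section Cylinders

/-! ### The `π`-system of initial boxes in a sequence space -/

variable {Ω : Type*} [MeasurableSpace Ω]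

/-- The sequences whose first `n + 1` terms lie in `B 0`, …, `B n`. -/
def initialBox (n : ℕ) (B : ℕ → {B : Set Ω // MeasurableSet B}) : Set (ℕ → Ω) :=
  {ω | ∀ k < n + 1, ω k ∈ (B k : Set Ω)}

lemma measurableSet_initialBox (n : ℕ) (B : ℕ → {B : Set Ω // MeasurableSet B}) :
    MeasurableSet (initialBox n B) := by
  simp only [initialBox, Set.ofPred_forall]
  exact .iInter fun k => .iInter fun _ => measurable_pi_apply k (B k).2

lemma isPiSystem_initialBox :
    IsPiSystem (Set.range fun p : ℕ × (ℕ → {B : Set Ω // MeasurableSet B}) =>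
      initialBox p.1 p.2) := by
  rintro _ ⟨⟨n, B⟩, rfl⟩ _ ⟨⟨m, C⟩, rfl⟩ -
  refine ⟨⟨max n m, fun k => (if k < n + 1 then B k else ⊤) ⊓ (if k < m + 1 then C k else ⊤)⟩, ?_⟩
  ext ω
  simp only [initialBox, Set.mem_ofPred_eq, Set.mem_inter_iff]
  constructor
  · intro h
    constructor
    · intro k hk
      have := (h k (by omega)).1
      simpa [hk] using this
    · intro k hk
      have := (h k (by omega)).2
      simpa [hk] using this
  · rintro ⟨h, h'⟩ k -
    constructor
    · split_ifs with hk
      exacts [h k hk, trivial]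
    · split_ifs with hk
      exacts [h' k hk, trivial]

lemma generateFrom_initialBox :
    (MeasurableSpace.pi : MeasurableSpace (ℕ → Ω)) = MeasurableSpace.generateFrom
      (Set.range fun p : ℕ × (ℕ → {B : Set Ω // MeasurableSet B}) => initialBox p.1 p.2) := by
  refine le_antisymm (iSup_le fun j => ?_) (MeasurableSpace.generateFrom_le ?_)
  · rintro _ ⟨t, ht, rfl⟩
    refine MeasurableSpace.measurableSet_generateFrom
      ⟨⟨j, fun k => if k = j then ⟨t, ht⟩ else ⊤⟩, ?_⟩
    ext ω
    simp only [initialBox, Set.mem_ofPred_eq, Set.mem_preimage]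
    constructor
    · intro h
      simpa using h j (by omega)
    · intro h k _
      split_ifs with hk
      exacts [hk ▸ h, trivial]
  · rintro _ ⟨p, rfl⟩
    exact measurableSet_initialBox p.1 p.2

end Cylinders

section Instrument

/-! ### Effects of an instrument -/

open Filter Topology

variable {Ω : Type*} [MeasurableSpace Ω]
  {H : Type*} [NormedAddCommGroup H] [InnerProductSpace ℂ H] [CompleteSpace H]

omit [CompleteSpace H] in
/-- Ultraweak sums are weak sums: a vector functional is the ultraweak functional of a sequence with
a single nonzero term. -/
lemma hasSum_inner_of_hasSum_ultraweak {ι : Type*} {T : ι → H →L[ℂ] H} {S : H →L[ℂ] H}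
    (h : letI : TopologicalSpace (H →L[ℂ] H) := ultraweakTopology H; HasSum T S) (ψ : H) :
    HasSum (fun i => inner ℂ ψ (T i ψ)) (inner ℂ ψ (S ψ)) := by
  let x : ℕ → H := Pi.single 0 ψ
  have hx : Summable fun n => ‖x n‖ ^ 2 :=
    summable_of_ne_finset_zero (s := {0}) fun n hn => by
      simp [x, Pi.single_eq_of_ne (show n ≠ 0 by simpa using hn)]
  have heval : ∀ a : H →L[ℂ] H, ∑' n, inner ℂ (x n) (a (x n)) = inner ℂ ψ (a ψ) := by
    intro a
    rw [tsum_eq_single 0 fun n hn => by simp [x, Pi.single_eq_of_ne hn]]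
    simp [x]
  have hcont : @Continuous _ _ (ultraweakTopology H) _
      fun a : H →L[ℂ] H => (inner ℂ ψ (a ψ) : ℂ) := by
    simp only [← heval]
    exact continuous_iff_le_induced.2 <|
      iInf_le_of_le x <| iInf_le_of_le x <| iInf_le_of_le hx <| iInf_le_of_le hx le_rfl
  let φ : (H →L[ℂ] H) →+ ℂ :=
    { toFun := fun a => inner ℂ ψ (a ψ)
      map_zero' := by simp
      map_add' := by simp }
  let : TopologicalSpace (H →L[ℂ] H) := ultraweakTopology H
  exact h.map φ hcont

namespace CPInstrument

variable (I : CPInstrument Ω H)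

/-- The effect `I_{B 0} ∘ ⋯ ∘ I_{B (n - 1)} (1)` of the first `n` sets of a sequence. -/
noncomputable def effect (n : ℕ) (B : ℕ → {B : Set Ω // MeasurableSet B}) : H →L[ℂ] H :=
  I.comp n (fun i => B i) 1

lemma effect_zero (B : ℕ → {B : Set Ω // MeasurableSet B}) : I.effect 0 B = 1 := rfl

lemma effect_succ (n : ℕ) (B : ℕ → {B : Set Ω // MeasurableSet B}) :
    I.effect (n + 1) B = I.toMap (B 0) (I.effect n fun k => B (k + 1)) := rfl

lemma effect_nonneg (n : ℕ) (B : ℕ → {B : Set Ω // MeasurableSet B}) : 0 ≤ I.effect n B := by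
  induction n generalizing B with
  | zero => exact zero_le_one
  | succ n ih =>
    rw [effect_succ]
    exact map_nonneg (I.toMap (B 0)) (ih _)

lemma effect_congr {n : ℕ} {B B' : ℕ → {B : Set Ω // MeasurableSet B}} (h : ∀ i < n, B i = B' i) :
    I.effect n B = I.effect n B' := by
  rw [effect, effect, show (fun i : Fin n => B i) = fun i : Fin n => B' i from
    funext fun i => h i i.2]

lemma effect_succ_of_top {n : ℕ} {B : ℕ → {B : Set Ω // MeasurableSet B}} (hB : B n = ⊤) :
    I.effect (n + 1) B = I.effect n B := by
  induction n generalizing B with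
  | zero =>
    rw [effect_succ, hB, effect_zero, effect_zero]
    exact I.univ_one
  | succ n ih => rw [effect_succ, ih hB, ← effect_succ]

/-- The effect is ultraweakly countably additive in each set separately: the instrument is in
its outcome, and the maps applied afterwards are normal. -/
lemma hasSum_effect {n i : ℕ} (hi : i < n) (B : ℕ → {B : Set Ω // MeasurableSet B})
    (A : ℕ → Set Ω) (hA : ∀ j, MeasurableSet (A j)) (hd : Pairwise (Function.onFun Disjoint A)) :
    letI : TopologicalSpace (H →L[ℂ] H) := ultraweakTopology H
    HasSum (fun j => I.effect n (Function.update B i ⟨A j, hA j⟩))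
      (I.effect n (Function.update B i ⟨⋃ j, A j, MeasurableSet.iUnion hA⟩)) := by
  induction n generalizing i B with
  | zero => omega
  | succ n ih =>
    simp only [effect_succ]
    cases i with
    | zero => simpa using I.hasSum_iUnion A hA hd (I.effect n fun k => B (k + 1))
    | succ i =>
      have hupd : ∀ C : {B : Set Ω // MeasurableSet B},
          (fun k => Function.update B (i + 1) C (k + 1)) =
            Function.update (fun k => B (k + 1)) i C := by
        intro C
        funext k
        simp [Function.update_apply]
      simp only [hupd, Function.update_of_ne (Nat.succ_ne_zero i).symm]
      let : TopologicalSpace (H →L[ℂ] H) := ultraweakTopology H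
      exact (ih (by omega) fun k => B (k + 1)).map (I.toMap (B 0)) (I.normal (B 0))

/-- In the vector state `ψ`, the effects of an instrument form a pre-measure on cylinders. -/
lemma isCylinderPremeasure (ψ : H) :
    IsCylinderPremeasure fun n B => ENNReal.ofReal ((I.effect n B).reApplyInnerSelf ψ) where
  congr h := by rw [I.effect_congr h]
  succ_of_top h := by rw [I.effect_succ_of_top h]
  zero_ne_top := ENNReal.ofReal_ne_top
  exists_measure := by
    intro n i B hi
    have hsum : ∀ (A : ℕ → Set Ω) (hA : ∀ j, MeasurableSet (A j)),
        Pairwise (Function.onFun Disjoint A) →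
        HasSum (fun j => (I.effect n (Function.update B i ⟨A j, hA j⟩)).reApplyInnerSelf ψ)
          ((I.effect n (Function.update B i ⟨⋃ j, A j, .iUnion hA⟩)).reApplyInnerSelf ψ) := by
      intro A hA hd
      have := Complex.hasSum_re (hasSum_inner_of_hasSum_ultraweak (I.hasSum_effect hi B A hA hd) ψ)
      simp only [ContinuousLinearMap.reApplyInnerSelf_apply, inner_re_symm (𝕜 := ℂ) _ ψ]
      exact this
    refine ⟨Measure.ofMeasurable (fun A hA => ENNReal.ofReal
      ((I.effect n (Function.update B i ⟨A, hA⟩)).reApplyInnerSelf ψ)) ?_ ?_, fun A => ?_⟩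
    · -- a constant sequence with a sum is zero
      have := (hsum (fun _ => ∅) (fun _ => .empty) fun _ _ _ => disjoint_bot_left).summable
      rw [summable_const_iff] at this
      exact (congrArg ENNReal.ofReal this).trans ENNReal.ofReal_zero
    · intro A hA hd
      rw [← (hsum A hA hd).tsum_eq, ENNReal.ofReal_tsum_of_nonneg
        (fun j => ContinuousLinearMap.reApplyInnerSelf_nonneg (I.effect_nonneg _ _) ψ)
        (hsum A hA hd).summable]
    · exact Measure.ofMeasurable_apply _ A.2

end CPInstrument

end Instrument

/-! ### The infinite composition -/

theorem theorem3 {Ω : Type*} [MeasurableSpace Ω] [StandardBorelSpace Ω]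
    {H : Type*} [NormedAddCommGroup H] [InnerProductSpace ℂ H] [CompleteSpace H]
    (I : CPInstrument Ω H) :
    ∃! E : POVM (ℕ → Ω) H,
      ∀ n : ℕ, 1 ≤ n → ∀ B : Fin n → {B : Set Ω // MeasurableSet B},
        E.eval {ω : ℕ → Ω | ∀ i : Fin n, ω i ∈ (B i : Set Ω)} = I.comp n B 1 := by
  choose μ hfin hμ using fun ψ => (I.isCylinderPremeasure ψ).exists_measure_cylinder
  have hμ' : ∀ ψ n B, (μ ψ).real {ω | ∀ k < n, ω k ∈ (B k : Set Ω)} =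
      (I.effect n B).reApplyInnerSelf ψ := fun ψ n B => by
    rw [measureReal_def, hμ,
      ENNReal.toReal_ofReal (ContinuousLinearMap.reApplyInnerSelf_nonneg (I.effect_nonneg n B) ψ)]
  obtain ⟨E, hE⟩ := exists_povm_of_measure (μ := μ) generateFrom_initialBox isPiSystem_initialBox
    (fun ψ => by
      have h := hμ' ψ 0 ⊤
      simp only [not_lt_zero, IsEmpty.forall_iff, implies_true, I.effect_zero] at h
      rw [← Set.ofPred_true, h]
      simpa [ContinuousLinearMap.reApplyInnerSelf_apply] using inner_self_eq_norm_sq (𝕜 := ℂ) ψ)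
    (by
      rintro _ ⟨⟨n, B⟩, rfl⟩
      exact ⟨I.effect (n + 1) B, I.effect_nonneg _ _, fun ψ => (hμ' ψ (n + 1) B).symm⟩)
  refine ⟨E, fun n hn B => ?_, fun E' hE' => ?_⟩
  · let B' : ℕ → {B : Set Ω // MeasurableSet B} := fun k => if hk : k < n then B ⟨k, hk⟩ else ⊤
    have hB : (fun i : Fin n => B' i) = B := funext fun i => by simp [B']
    have hset : {ω : ℕ → Ω | ∀ i : Fin n, ω i ∈ (B i : Set Ω)} =
        {ω | ∀ k < n, ω k ∈ (B' k : Set Ω)} := by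
      ext ω
      rw [← hB]
      exact Fin.forall_iff
    obtain ⟨m, rfl⟩ : ∃ m, n = m + 1 := ⟨n - 1, by omega⟩
    rw [hset, show I.comp (m + 1) B 1 = I.effect (m + 1) B' by rw [CPInstrument.effect, hB]]
    have hmeas := measurableSet_initialBox m B'
    exact ContinuousLinearMap.eq_of_reApplyInnerSelf_eq (E.nonneg _ hmeas) (I.effect_nonneg _ _)
      fun ψ => (hE _ hmeas ψ).trans (hμ' ψ (m + 1) B')
  · refine POVM.ext_of_generateFrom generateFrom_initialBox isPiSystem_initialBox ?_
    rintro _ ⟨⟨n, B⟩, rfl⟩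
    have hmeas := measurableSet_initialBox n B
    have hset : initialBox n B = {ω | ∀ i : Fin (n + 1), ω i ∈ (B i : Set Ω)} := by
      ext ω
      exact ⟨fun h i => h i i.2, fun h k hk => h ⟨k, hk⟩⟩
    refine Eq.trans ?_ (ContinuousLinearMap.eq_of_reApplyInnerSelf_eq (E.nonneg _ hmeas)
      (I.effect_nonneg (n + 1) B) fun ψ => (hE _ hmeas ψ).trans (hμ' ψ (n + 1) B)).symm
    exact (congrArg E'.eval hset).trans <| hE' (n + 1) (by omega) fun i => B i
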